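/- Fix $\varepsilon>0$ and an irrational rotation angle $\alpha\in\mathbb R/\mathbb Z$, identified with its representative in $(0,1)$. Let $q_n$ $(n\ge 0,\ q_0=1)$ be the denominators of the rational convergents of the continued fraction of $\alpha$. For integers $j\ge1$ and $r\ge 0$ put $$u_{j}(r)=c(\varepsilon)\sqrt{4\sin^2(\pi j\alpha)\,r^2+j^2},\qquad c(\varepsilon)=\frac1{\sqrt{2\cosh\varepsilon-2}},\qquad \mathscr B_\alpha(r)=\inf_{j\ge1}u_{j}(r).$$ Call $u_j$ a constituent of $\mathscr B_\alpha$ if $u_j=\mathscr B_\alpha$ on some non-empty open interval of $[0,\infty)$. Theorem. There is a universal constant $C\ge1$, independent of $\alpha$, $\varepsilon$ and $n$, such that for every $\varepsilon>0$ and every irrational $\alpha$ the following holds for all sufficiently large $n$ (how large may depend on $\alpha$ and $\varepsilon$): if $u_{q_n}$ is a constituent of $\mathscr B_\alpha$, then any maximal interval on which $u_{q_n}=\mathscr B_\alpha$ is of the form $[x,y]$ with $x<y$, and $$C^{-1}q_n^2\le x\le C\,q_n^2\qquad\text{and}\qquad C^{-1}q_{n+1}^2\le y\le C\,q_{n+1}^2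 .$$ -/

import Mathlib

/-- The denominators of the convergents of the continued fraction of a real number, as computed by
Mathlib's `GenContFract.of`, are natural numbers. -/
theorem dens_of_eq_natCast (α : ℝ) (n : ℕ) :
    ∃ m : ℕ, (GenContFract.of α).dens n = (m : ℝ) := by
  induction n using Nat.strong_induction_on with
  | _ n ih =>
    match n, ih with
    | 0, _ => exact ⟨1, by simp⟩
    | 1, _ =>
      rcases h : (GenContFract.of α).s.get? 0 with _ | gp
      · refine ⟨1, ?_⟩
        rw [GenContFract.dens_stable_of_terminated (n := 0) (Nat.zero_le 1) h]
        simp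
      · have hb := GenContFract.partDen_eq_s_b h
        obtain ⟨z, hz⟩ := GenContFract.exists_int_eq_of_partDen hb
        have h1 := GenContFract.of_one_le_get?_partDen hb
        have hz0 : 0 ≤ z := by
          have : (1 : ℝ) ≤ (z : ℝ) := hz ▸ h1
          have : (0 : ℝ) ≤ (z : ℝ) := by linarith
          exact_mod_cast this
        lift z to ℕ using hz0
        refine ⟨z, ?_⟩
        rw [GenContFract.first_den_eq h, hz]
        simp
    | n + 2, ih =>
      obtain ⟨m0, h0⟩ := ih n (by omega)
      obtain ⟨m1, h1⟩ := ih (n + 1) (by omega)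
      rcases h : (GenContFract.of α).s.get? (n + 1) with _ | gp
      · refine ⟨m1, ?_⟩
        rw [GenContFract.dens_stable_of_terminated (n := n + 1) (Nat.le_succ _) h, h1]
      · have ha := GenContFract.of_partNum_eq_one (GenContFract.partNum_eq_s_a h)
        have hb := GenContFract.partDen_eq_s_b h
        obtain ⟨z, hz⟩ := GenContFract.exists_int_eq_of_partDen hb
        have hle := GenContFract.of_one_le_get?_partDen hb
        have hz0 : 0 ≤ z := by
          have : (1 : ℝ) ≤ (z : ℝ) := hz ▸ hle
          have : (0 : ℝ) ≤ (z : ℝ) := by linarith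
          exact_mod_cast this
        lift z to ℕ using hz0
        refine ⟨z * m1 + m0, ?_⟩
        rw [GenContFract.dens_recurrence h h0 h1, ha, hz]
        push_cast
        ring

/-- `convDenom α n` is the denominator `q_n` of the `n`-th convergent of the continued fraction
of `α`, as a natural number (so `q_0 = 1`, and `q_1 = a_1` for `0 < α < 1`). -/
noncomputable def convDenom (α : ℝ) (n : ℕ) : ℕ := ⌊(GenContFract.of α).dens n⌋₊

/-- The floor in the definition of `convDenom` only changes the type. -/
theorem convDenom_cast (α : ℝ) (n : ℕ) :
    (convDenom α n : ℝ) = (GenContFract.of α).dens n := by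
  obtain ⟨m, hm⟩ := dens_of_eq_natCast α n
  rw [convDenom, hm, Nat.floor_natCast]

/-- The function `u_{α,j}(r) = c(ε) √(4 sin²(π j α) r² + j²)`, `c(ε) = 1 / √(2 cosh ε - 2)`. -/
noncomputable def displacementFn (ε α : ℝ) (j : ℕ) (r : ℝ) : ℝ :=
  1 / √(2 * Real.cosh ε - 2) * √(4 * Real.sin (Real.pi * j * α) ^ 2 * r ^ 2 + (j : ℝ) ^ 2)

/-- The boundary function `𝓑_α(r) = inf_{j ≥ 1} u_{α,j}(r)`. -/
noncomputable def boundaryFn (ε α : ℝ) (r : ℝ) : ℝ :=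
  ⨅ j : ℕ+, displacementFn ε α (j : ℕ) r

/-- The set of `r ∈ [0,∞)` at which `u_{α,j}(r) = 𝓑_α(r)`. -/
def coincidenceSet (ε α : ℝ) (j : ℕ) : Set ℝ :=
  {r | 0 ≤ r ∧ displacementFn ε α j r = boundaryFn ε α r}

/-- `u_{α,j}` is a constituent of `𝓑_α`: the two functions agree on some non-empty open
interval of `[0,∞)`. -/
def IsConstituent (ε α : ℝ) (j : ℕ) : Prop :=
  ∃ a b : ℝ, a < b ∧ Set.Ioo a b ⊆ coincidenceSet ε α j

/-- `I` is a maximal interval on which `u_{α,j} = 𝓑_α`. (Intervals of the real line, of any kind,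
are its order-connected subsets.) -/
def IsMaximalInterval (ε α : ℝ) (j : ℕ) (I : Set ℝ) : Prop :=
  Maximal (fun J : Set ℝ => J.OrdConnected ∧ J ⊆ coincidenceSet ε α j) I

/-! After dividing out c(ε) and squaring, u_j becomes the line s_j t + j² in t = r², with s_j = 4
sin²(πjα), so 𝓑_α is governed by a lower envelope of lines. The coincidence set of one line is
therefore a closed interval: indices below j can only constrain its left end, indices above j only
its right end.

Write E_n = |q_n α - p_n|. Since 1/2 ≤ q_{n+1} E_n ≤ 1, the slope of q_n is of order q_{n+1}⁻², and
it is minimal among all j < q_{n+1}. Hence the lines of q_n and q_{n+1} should cross at r of order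
q_{n+1}². This fails only if their slopes or their intercepts are too close. If E_n < 2E_{n+1}, the
partial quotient is 1 and q_{n+2} ≤ 2q_{n+1} can replace q_{n+1}; if q_{n+2} < 2q_{n+1}, then q_n ≤
q_{n+2}/2 can replace q_{n+1}. These substitutions cost only constants. They bound every point of
the coincidence set (`sq_convDenom_le_of_mem`, `le_sq_convDenom_of_mem`). The two remaining bounds
follow by extremality: an endpoint violating them could be moved outward. -/

/-! ### Convergents and their approximation errors. -/

/-- The numerator of the `n`-th convergent of the continued fraction of `α`. -/
noncomputable def convNum (α : ℝ) (n : ℕ) : ℤ := ⌊(GenContFract.of α).nums n⌋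

/-- The approximation error `|q_n α - p_n| = (-1)^n (q_n α - p_n)` of the `n`-th convergent. -/
noncomputable def convErr (α : ℝ) (n : ℕ) : ℝ :=
  (-1) ^ n * ((convDenom α n : ℝ) * α - (convNum α n : ℝ))

theorem convDenom_le_succ (α : ℝ) (n : ℕ) : convDenom α n ≤ convDenom α (n + 1) := by
  have := GenContFract.of_den_mono (v := α) (n := n)
  rw [← convDenom_cast, ← convDenom_cast] at this
  exact_mod_cast this

namespace Irrational

variable {α : ℝ} (hα : Irrational α)
include hα

theorem not_terminatedAt (n : ℕ) : ¬(GenContFract.of α).TerminatedAt n := by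
  intro h
  obtain ⟨q, hq⟩ := (GenContFract.terminates_iff_rat α).1 ⟨n, h⟩
  exact hα ⟨q, hq.symm⟩

theorem exists_get?_eq (n : ℕ) :
    ∃ a : ℕ, 1 ≤ a ∧ (GenContFract.of α).s.get? n = some ⟨1, (a : ℝ)⟩ := by
  rcases h : (GenContFract.of α).s.get? n with _ | gp
  · exact absurd h (hα.not_terminatedAt n)
  · have hb := GenContFract.partDen_eq_s_b h
    obtain ⟨ha, z, hz⟩ := GenContFract.of_partNum_eq_one_and_exists_int_partDen_eq h
    have h1 : (1 : ℝ) ≤ z := hz ▸ GenContFract.of_one_le_get?_partDen hb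
    have h1 : 1 ≤ z := by exact_mod_cast h1
    lift z to ℕ using by omega
    refine ⟨z, by omega, ?_⟩
    cases gp
    simp_all

theorem convNum_cast (n : ℕ) : (convNum α n : ℝ) = (GenContFract.of α).nums n := by
  suffices ∃ m : ℤ, (GenContFract.of α).nums n = (m : ℝ) by
    obtain ⟨m, hm⟩ := this
    rw [convNum, hm, Int.floor_intCast]
  induction n using Nat.strong_induction_on with
  | _ n ih =>
    match n, ih with
    | 0, _ => exact ⟨⌊α⌋, by simp⟩
    | 1, _ =>
      obtain ⟨a, -, h⟩ := hα.exists_get?_eq 0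
      refine ⟨a * ⌊α⌋ + 1, ?_⟩
      rw [GenContFract.first_num_eq h]
      simp
    | n + 2, ih =>
      obtain ⟨m0, h0⟩ := ih n (by omega)
      obtain ⟨m1, h1⟩ := ih (n + 1) (by omega)
      obtain ⟨a, -, h⟩ := hα.exists_get?_eq (n + 1)
      refine ⟨a * m1 + m0, ?_⟩
      rw [GenContFract.nums_recurrence h h0 h1]
      push_cast
      ring

theorem exists_recurrence (n : ℕ) :
    ∃ a : ℕ, 1 ≤ a ∧ convDenom α (n + 2) = a * convDenom α (n + 1) + convDenom α n ∧
      convNum α (n + 2) = a * convNum α (n + 1) + convNum α n := by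
  obtain ⟨a, ha, h⟩ := hα.exists_get?_eq (n + 1)
  refine ⟨a, ha, ?_, ?_⟩
  · have := GenContFract.dens_recurrence h rfl rfl
    simp only [← convDenom_cast, one_mul] at this
    exact_mod_cast this
  · have := GenContFract.nums_recurrence h rfl rfl
    simp only [← hα.convNum_cast, one_mul] at this
    exact_mod_cast this

theorem fib_le_convDenom (n : ℕ) : Nat.fib (n + 1) ≤ convDenom α n := by
  have := GenContFract.succ_nth_fib_le_of_nth_den (v := α) (n := n)
    (Or.inr (hα.not_terminatedAt _))
  rw [← convDenom_cast] at this
  exact_mod_cast this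

theorem one_le_convDenom (n : ℕ) : 1 ≤ convDenom α n :=
  (Nat.fib_pos.2 n.succ_pos).trans_le (hα.fib_le_convDenom n)

theorem convNum_mul_sub (n : ℕ) :
    convNum α n * convDenom α (n + 1) - convDenom α n * convNum α (n + 1) = (-1) ^ (n + 1) := by
  have := SimpContFract.determinant (s := SimpContFract.of α) (hα.not_terminatedAt n)
  change (GenContFract.of α).nums n * (GenContFract.of α).dens (n + 1) -
    (GenContFract.of α).dens n * (GenContFract.of α).nums (n + 1) = _ at this
  simp only [← convDenom_cast, ← hα.convNum_cast] at this
  exact_mod_cast this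

theorem convErr_pos (n : ℕ) : 0 < convErr α n := by
  have hq : (0 : ℝ) < convDenom α n := by exact_mod_cast hα.one_le_convDenom n
  obtain ⟨ifp, hs, -⟩ := GenContFract.IntFractPair.exists_succ_get?_stream_of_gcf_of_get?_eq_some
    (hα.exists_get?_eq n).choose_spec.2
  obtain ⟨ifp', hs', hne, -⟩ := GenContFract.IntFractPair.succ_nth_stream_eq_some_iff.1 hs
  have hfr : 0 < ifp'.fr :=
    lt_of_le_of_ne (GenContFract.IntFractPair.nth_stream_fr_nonneg hs') hne.symm
  have h := GenContFract.sub_convs_eq hs'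
  simp only [hne, if_false] at h
  rw [← GenContFract.nth_cont_eq_succ_nth_contAux, ← GenContFract.den_eq_conts_b,
    ← convDenom_cast, GenContFract.conv_eq_num_div_den, ← convDenom_cast,
    ← hα.convNum_cast] at h
  have hB := GenContFract.zero_le_of_contsAux_b (v := α) (n := n)
  have hD : 0 < ifp'.fr⁻¹ * convDenom α n + ((GenContFract.of α).contsAux n).b := by positivity
  -- `contsAux n` carries the index n - 1, so this is E_n = 1 / (q_n / fr + q_{n-1}), with 0 in
  -- place of q_{n-1} when n = 0.
  have key : convErr α n = 1 / (ifp'.fr⁻¹ * convDenom α n +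
      ((GenContFract.of α).contsAux n).b) := by
    have hx : (convDenom α n : ℝ) * α - convNum α n =
        convDenom α n * (α - convNum α n / convDenom α n) := by field_simp
    have hsq : ((-1 : ℝ) ^ n) * (-1) ^ n = 1 := by rw [← mul_pow]; simp
    rw [convErr, hx, h]
    field_simp
    linear_combination hsq
  rw [key]
  positivity

theorem convDenom_mul_convErr_add (n : ℕ) :
    convDenom α (n + 1) * convErr α n + convDenom α n * convErr α (n + 1) = 1 := by
  have h : (convNum α n : ℝ) * convDenom α (n + 1) - convDenom α n * convNum α (n + 1) =
      (-1) ^ (n + 1) := by exact_mod_cast hα.convNum_mul_sub n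
  have hsq : ((-1 : ℝ) ^ n) * (-1) ^ n = 1 := by rw [← mul_pow]; simp
  simp only [convErr]
  rw [pow_succ] at h ⊢
  linear_combination (-(-1) ^ n) * h + hsq

theorem exists_recurrence_convErr (n : ℕ) :
    ∃ a : ℕ, 1 ≤ a ∧ convDenom α (n + 2) = a * convDenom α (n + 1) + convDenom α n ∧
      convErr α n = a * convErr α (n + 1) + convErr α (n + 2) := by
  obtain ⟨a, ha, hq, hp⟩ := hα.exists_recurrence n
  refine ⟨a, ha, hq, ?_⟩
  simp only [convErr, hq, hp]
  push_cast
  ring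

theorem convErr_succ_lt (n : ℕ) : convErr α (n + 1) < convErr α n := by
  obtain ⟨a, ha, -, h⟩ := hα.exists_recurrence_convErr n
  have h1 : (1 : ℝ) ≤ a := by exact_mod_cast ha
  nlinarith [hα.convErr_pos (n + 1), hα.convErr_pos (n + 2)]

theorem convDenom_succ_mul_convErr_le (n : ℕ) : convDenom α (n + 1) * convErr α n ≤ 1 := by
  have := hα.convDenom_mul_convErr_add n
  have : 0 ≤ convDenom α n * convErr α (n + 1) :=
    mul_nonneg (Nat.cast_nonneg _) (hα.convErr_pos _).le
  linarith

theorem one_le_two_mul_convErr (n : ℕ) : 1 ≤ 2 * (convDenom α (n + 1) * convErr α n) := by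
  have := hα.convDenom_mul_convErr_add n
  have hq : (convDenom α n : ℝ) ≤ convDenom α (n + 1) := by exact_mod_cast convDenom_le_succ α n
  have : convDenom α n * convErr α (n + 1) ≤ convDenom α (n + 1) * convErr α n :=
    mul_le_mul hq (hα.convErr_succ_lt n).le (hα.convErr_pos _).le (Nat.cast_nonneg _)
  linarith

/-- If consecutive errors are comparable, the partial quotient between them is one. -/
theorem recurrence_of_convErr_lt {n : ℕ} (h : convErr α n < 2 * convErr α (n + 1)) :
    convDenom α (n + 2) = convDenom α (n + 1) + convDenom α n ∧
      convErr α n = convErr α (n + 1) + convErr α (n + 2) := by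
  obtain ⟨a, ha, hq, hE⟩ := hα.exists_recurrence_convErr n
  have h1 := hα.convErr_pos (n + 1)
  have h2 := hα.convErr_pos (n + 2)
  have : (a : ℝ) < 2 := by nlinarith
  have : a < 2 := by exact_mod_cast this
  obtain rfl : a = 1 := by omega
  simp_all

theorem two_mul_convDenom_le (n : ℕ) : 2 * convDenom α n ≤ convDenom α (n + 2) := by
  obtain ⟨a, ha, hq, -⟩ := hα.exists_recurrence n
  have := convDenom_le_succ α n
  nlinarith

/-- The convergents are best approximations of the second kind. -/
theorem convErr_le_abs {n j : ℕ} (hj : 1 ≤ j) (hjq : j < convDenom α (n + 1)) (p : ℤ) :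
    convErr α n ≤ |j * α - p| := by
  set q := convDenom α n
  set q' := convDenom α (n + 1)
  have hq : 1 ≤ q := hα.one_le_convDenom n
  have hdet : convNum α n * q' - q * convNum α (n + 1) = (-1) ^ (n + 1) := hα.convNum_mul_sub n
  set s : ℤ := (-1) ^ n
  have hs : s * s = 1 := by simp only [s]; rw [← mul_pow]; simp
  have hdet : convNum α n * q' - q * convNum α (n + 1) = -s := by rw [hdet, pow_succ]; ring
  -- By the determinant identity, consecutive convergents form a basis of ℤ²; a and b are the
  -- coordinates of (j, p) by Cramer's rule. The range of j forces a ≠ 0 and ab ≤ 0, so the two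
  -- errors add up instead of cancelling.
  set a : ℤ := s * (j * convNum α (n + 1) - p * q')
  set b : ℤ := s * (p * q - j * convNum α n)
  have hja : (j : ℤ) = a * q + b * q' := by
    simp only [a, b]; linear_combination (s * j) * hdet - j * hs
  have hpa : p = a * convNum α n + b * convNum α (n + 1) := by
    simp only [a, b]; linear_combination (s * p) * hdet - p * hs
  have hjr : (j : ℝ) = a * q + b * q' := by exact_mod_cast hja
  have hpr : (p : ℝ) = a * convNum α n + b * convNum α (n + 1) := by exact_mod_cast hpa
  have hsr : ((-1 : ℝ) ^ n) * (-1) ^ n = 1 := by rw [← mul_pow]; simp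
  have habs : |j * α - p| = |a * convErr α n - b * convErr α (n + 1)| := by
    have : a * convErr α n - b * convErr α (n + 1) = (-1) ^ n * (j * α - p) := by
      rw [hjr, hpr, convErr, convErr, pow_succ]; ring
    rw [this, abs_mul, abs_pow]; simp
  have h0 := hα.convErr_pos n
  have h1 := hα.convErr_pos (n + 1)
  have hjq' : (j : ℤ) < q' := by exact_mod_cast hjq
  have hj' : (1 : ℤ) ≤ j := by exact_mod_cast hj
  have hqz : (1 : ℤ) ≤ q := by exact_mod_cast hq
  rw [habs]
  rcases lt_trichotomy a 0 with ha | ha | ha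
  · have hb : 0 ≤ b := by by_contra! hb; nlinarith
    have har : (a : ℝ) ≤ -1 := by exact_mod_cast (by omega : a ≤ -1)
    have hbr : (0 : ℝ) ≤ b := by exact_mod_cast hb
    refine le_trans ?_ (neg_le_abs _)
    nlinarith [mul_nonneg hbr h1.le]
  · have hb : 1 ≤ b := by by_contra! hb; rw [ha] at hja; nlinarith
    rw [ha] at hja
    nlinarith
  · have hb : b ≤ 0 := by by_contra! hb; nlinarith
    have har : (1 : ℝ) ≤ a := by exact_mod_cast ha
    have hbr : (b : ℝ) ≤ 0 := by exact_mod_cast hb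
    refine le_trans ?_ (le_abs_self _)
    nlinarith [mul_nonneg (neg_nonneg.2 hbr) h1.le]

theorem tendsto_convDenom : Filter.Tendsto (convDenom α) Filter.atTop Filter.atTop := by
  refine Filter.tendsto_atTop_mono (fun n => ?_) Filter.tendsto_id
  induction n using Nat.strong_induction_on with
  | _ n ih =>
    match n, ih with
    | 0, _ => simp
    | 1, _ => exact hα.one_le_convDenom 1
    | n + 2, ih =>
      have h1 : n + 1 ≤ convDenom α (n + 1) := ih (n + 1) (by omega)
      obtain ⟨a, ha, hq, -⟩ := hα.exists_recurrence n
      have := hα.one_le_convDenom n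
      change n + 2 ≤ _
      nlinarith

end Irrational

/-! ### Slopes and sine estimates. -/

/-- The coefficient of `r ^ 2` in the square of `displacementFn`, up to the constant `c(ε) ^ 2`. -/
noncomputable def sineSlope (α : ℝ) (j : ℕ) : ℝ := 4 * Real.sin (Real.pi * j * α) ^ 2

theorem sineSlope_nonneg (α : ℝ) (j : ℕ) : 0 ≤ sineSlope α j := by unfold sineSlope; positivity

theorem sineSlope_eq_sub_int (α : ℝ) (j : ℕ) (p : ℤ) :
    sineSlope α j = 4 * Real.sin (Real.pi * (j * α - p)) ^ 2 := by
  have h : Real.pi * (j * α - p) = Real.pi * j * α - p * Real.pi := by ring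
  rw [sineSlope, h, Real.sin_sub_int_mul_pi, mul_pow]
  rcases Int.even_or_odd p with hp | hp <;> simp [hp.neg_one_zpow]

theorem sin_sq_sub_sin_sq (a b : ℝ) :
    Real.sin a ^ 2 - Real.sin b ^ 2 = Real.sin (a + b) * Real.sin (a - b) := by
  rw [Real.sin_add, Real.sin_sub]
  linear_combination Real.sin b ^ 2 * Real.sin_sq_add_cos_sq a -
    Real.sin a ^ 2 * Real.sin_sq_add_cos_sq b

theorem two_mul_le_sin_pi_mul {x : ℝ} (h0 : 0 ≤ x) (h1 : x ≤ 1 / 2) :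
    2 * x ≤ Real.sin (Real.pi * x) := by
  have := Real.mul_le_sin (x := Real.pi * x) (by positivity) (by nlinarith [Real.pi_pos])
  calc 2 * x = 2 / Real.pi * (Real.pi * x) := by field_simp
    _ ≤ _ := this

/-- The difference factors as 4 sin π(a+b) sin π(a-b), and each factor is bounded below by Jordan's
inequality. This separates the slopes when one error is at most half the other. -/
theorem eight_mul_sq_le_sin_sq_sub {a b : ℝ} (hb : 0 ≤ b) (hba : 2 * b ≤ a) (ha : a ≤ 1 / 4) :
    8 * a ^ 2 ≤ 4 * Real.sin (Real.pi * a) ^ 2 - 4 * Real.sin (Real.pi * b) ^ 2 := by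
  have h1 := two_mul_le_sin_pi_mul (x := a + b) (by linarith) (by linarith)
  have h2 := two_mul_le_sin_pi_mul (x := a - b) (by linarith) (by linarith)
  have h3 : (2 * a) * a ≤ Real.sin (Real.pi * (a + b)) * Real.sin (Real.pi * (a - b)) :=
    mul_le_mul (by linarith) (by linarith) (by linarith) (by linarith)
  rw [mul_add, mul_sub, ← sin_sq_sub_sin_sq] at h3
  linarith

/-! ### The envelope of lines in r². -/

theorem displacementFn_le_displacementFn_iff {ε : ℝ} (hε : 0 < ε) (α r : ℝ) (i j : ℕ) :
    displacementFn ε α i r ≤ displacementFn ε α j r ↔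
      sineSlope α i * r ^ 2 + (i : ℝ) ^ 2 ≤ sineSlope α j * r ^ 2 + (j : ℝ) ^ 2 := by
  have hc : 0 < 1 / √(2 * Real.cosh ε - 2) := by
    have := Real.one_lt_cosh.2 hε.ne'
    have : 0 < 2 * Real.cosh ε - 2 := by linarith
    positivity
  unfold displacementFn sineSlope
  rw [mul_le_mul_iff_right₀ hc, Real.sqrt_le_sqrt_iff (by positivity)]

theorem mem_coincidenceSet_iff {ε : ℝ} (hε : 0 < ε) (α r : ℝ) {i : ℕ} (hi : 1 ≤ i) :
    r ∈ coincidenceSet ε α i ↔ 0 ≤ r ∧ ∀ j : ℕ, 1 ≤ j →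
      sineSlope α i * r ^ 2 + (i : ℝ) ^ 2 ≤ sineSlope α j * r ^ 2 + (j : ℝ) ^ 2 := by
  have hbdd : BddBelow (Set.range fun j : ℕ+ => displacementFn ε α j r) :=
    ⟨0, by rintro _ ⟨j, rfl⟩; simp only [displacementFn]; positivity⟩
  refine and_congr_right fun _ => ⟨fun h j hj => ?_, fun h => ?_⟩
  · rw [← displacementFn_le_displacementFn_iff hε, h]
    exact ciInf_le hbdd (⟨j, hj⟩ : ℕ+)
  · refine le_antisymm (le_ciInf fun j => ?_) (ciInf_le hbdd (⟨i, hi⟩ : ℕ+))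
    exact (displacementFn_le_displacementFn_iff hε ..).2 (h j j.pos)

theorem isClosed_coincidenceSet {ε : ℝ} (hε : 0 < ε) (α : ℝ) {i : ℕ} (hi : 1 ≤ i) :
    IsClosed (coincidenceSet ε α i) := by
  have : coincidenceSet ε α i = {r | 0 ≤ r} ∩ ⋂ j : ℕ, ⋂ _ : 1 ≤ j,
      {r | sineSlope α i * r ^ 2 + (i : ℝ) ^ 2 ≤ sineSlope α j * r ^ 2 + (j : ℝ) ^ 2} := by
    ext r
    simp [mem_coincidenceSet_iff hε α r hi]
  rw [this]
  refine (isClosed_le (by fun_prop) (by fun_prop)).inter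
    (isClosed_iInter fun j => isClosed_iInter fun _ => isClosed_le (by fun_prop) (by fun_prop))

/-- A line of smaller index has smaller intercept; if it is not below line i at x, its slope is at
least that of i, so it stays above to the right of x. Only larger indices need checking. -/
theorem mem_coincidenceSet_of_le_of_le {ε : ℝ} (hε : 0 < ε) {α x r : ℝ} {i : ℕ} (hi : 1 ≤ i)
    (hx : x ∈ coincidenceSet ε α i) (hxr : x ≤ r)
    (hy : ∀ j, i < j → sineSlope α i * r ^ 2 + (i : ℝ) ^ 2 ≤ sineSlope α j * r ^ 2 + (j : ℝ) ^ 2) :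
    r ∈ coincidenceSet ε α i := by
  rw [mem_coincidenceSet_iff hε α _ hi] at hx ⊢
  refine ⟨hx.1.trans hxr, fun j hj => ?_⟩
  rcases lt_or_ge i j with hij | hij
  · exact hy j hij
  · have h := hx.2 j hj
    have hij' : (j : ℝ) ≤ i := by exact_mod_cast hij
    have hsq : (j : ℝ) ^ 2 ≤ (i : ℝ) ^ 2 := by gcongr
    have hr : x ^ 2 ≤ r ^ 2 := pow_le_pow_left₀ hx.1 hxr 2
    rcases hij.eq_or_lt with rfl | hlt
    · rfl
    have hsq' : (j : ℝ) ^ 2 < (i : ℝ) ^ 2 := by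
      have : (j : ℝ) < i := by exact_mod_cast hlt
      gcongr
    have hs : sineSlope α i ≤ sineSlope α j := by
      by_contra! hs
      nlinarith [sq_nonneg x]
    nlinarith

/-- Mirror image: a line of larger index starts no lower at r = 0, so if it is not below line i at
y, it is not below anywhere in between. -/
theorem le_of_mem_coincidenceSet_of_le {ε : ℝ} (hε : 0 < ε) {α y r : ℝ} {i j : ℕ} (hi : 1 ≤ i)
    (hr : 0 ≤ r) (hry : r ≤ y) (hy : y ∈ coincidenceSet ε α i) (hij : i ≤ j) :
    sineSlope α i * r ^ 2 + (i : ℝ) ^ 2 ≤ sineSlope α j * r ^ 2 + (j : ℝ) ^ 2 := by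
  have h := ((mem_coincidenceSet_iff hε α _ hi).1 hy).2 j (hi.trans hij)
  have hij' : (i : ℝ) ≤ j := by exact_mod_cast hij
  have hsq : (i : ℝ) ^ 2 ≤ (j : ℝ) ^ 2 := by gcongr
  have hr : r ^ 2 ≤ y ^ 2 := pow_le_pow_left₀ hr hry 2
  rcases le_total (sineSlope α i) (sineSlope α j) with hs | hs
  · nlinarith [sq_nonneg r]
  · nlinarith

theorem ordConnected_coincidenceSet {ε : ℝ} (hε : 0 < ε) (α : ℝ) {i : ℕ} (hi : 1 ≤ i) :
    (coincidenceSet ε α i).OrdConnected :=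
  ⟨fun _ hx _ hy _ hr => mem_coincidenceSet_of_le_of_le hε hi hx hr.1 fun _ hij =>
    le_of_mem_coincidenceSet_of_le hε hi (hx.1.trans hr.1) hr.2 hy hij.le⟩

theorem IsMaximalInterval.eq_coincidenceSet {ε α : ℝ} (hε : 0 < ε) {i : ℕ} (hi : 1 ≤ i) {I : Set ℝ}
    (hI : IsMaximalInterval ε α i I) : I = coincidenceSet ε α i :=
  hI.eq_of_subset ⟨ordConnected_coincidenceSet hε α hi, subset_rfl⟩ hI.prop.2

theorem sineSlope_convDenom (α : ℝ) (n : ℕ) :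
    sineSlope α (convDenom α n) = 4 * Real.sin (Real.pi * convErr α n) ^ 2 := by
  rw [sineSlope_eq_sub_int α _ (convNum α n), convErr]
  rcases neg_one_pow_eq_or ℝ n with h | h
  · rw [h, one_mul]
  · rw [h, neg_one_mul, mul_neg, Real.sin_neg, neg_sq]

/-! ### Slopes at convergent denominators, and bounds for the endpoints. -/

namespace Irrational

variable {α : ℝ} (hα : Irrational α)
include hα

theorem sineSlope_convDenom_mul_sq_le (n : ℕ) :
    sineSlope α (convDenom α n) * (convDenom α (n + 1) : ℝ) ^ 2 ≤ 40 := by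
  have h0 := hα.convErr_pos n
  have h1 := hα.convDenom_succ_mul_convErr_le n
  have hs : Real.sin (Real.pi * convErr α n) ^ 2 ≤ (Real.pi * convErr α n) ^ 2 :=
    Real.sin_sq_le_sq
  have hpi : Real.pi ^ 2 ≤ 10 := by nlinarith [Real.pi_lt_d2, Real.pi_pos]
  have h2 : (convDenom α (n + 1) * convErr α n) ^ 2 ≤ 1 := pow_le_one₀ (by positivity) h1
  rw [sineSlope_convDenom]
  calc _ ≤ 4 * (Real.pi * convErr α n) ^ 2 * (convDenom α (n + 1) : ℝ) ^ 2 := by gcongr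
    _ = 4 * Real.pi ^ 2 * (convDenom α (n + 1) * convErr α n) ^ 2 := by ring
    _ ≤ 4 * 10 * 1 := by gcongr
    _ = 40 := by norm_num

-- The condition 4 ≤ q_{n+1} ensures E_n ≤ 1/4, the range of the sine estimate.
theorem two_le_sineSlope_sub_mul_sq {m n : ℕ} (hn : 4 ≤ convDenom α (n + 1))
    (h : 2 * convErr α m ≤ convErr α n) :
    2 ≤ (sineSlope α (convDenom α n) - sineSlope α (convDenom α m)) * (convDenom α (n + 1) : ℝ) ^ 2 := by
  have hn' : (4 : ℝ) ≤ convDenom α (n + 1) := by exact_mod_cast hn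
  have h0 := hα.convErr_pos n
  have h1 := hα.convDenom_succ_mul_convErr_le n
  have h2 := eight_mul_sq_le_sin_sq_sub (hα.convErr_pos m).le h (by nlinarith)
  have h3 := hα.one_le_two_mul_convErr n
  rw [sineSlope_convDenom, sineSlope_convDenom]
  calc (2 : ℝ) = 2 * 1 ^ 2 := by norm_num
    _ ≤ 2 * (2 * (convDenom α (n + 1) * convErr α n)) ^ 2 := by gcongr
    _ = 8 * convErr α n ^ 2 * (convDenom α (n + 1) : ℝ) ^ 2 := by ring
    _ ≤ _ := by gcongr

theorem sineSlope_convDenom_le {n j : ℕ} (hj : 1 ≤ j) (hjq : j < convDenom α (n + 1)) :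
    sineSlope α (convDenom α n) ≤ sineSlope α j := by
  have h := hα.convErr_le_abs hj hjq (round (j * α))
  have h0 := hα.convErr_pos n
  -- With the nearest integer subtracted, both arguments of the sine lie in [0, π/2] up to sign,
  -- where it is monotone.
  have h1 := abs_sub_round (j * α)
  rw [sineSlope_convDenom, sineSlope_eq_sub_int α j (round (j * α)), ← sq_abs (Real.sin (_ * (_ - _))),
    Real.abs_sin_eq_sin_abs_of_abs_le_pi (by
      rw [abs_mul, abs_of_pos Real.pi_pos]; nlinarith [Real.pi_pos]), abs_mul,
    abs_of_pos Real.pi_pos]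
  have hpi := Real.pi_pos
  have := Real.sin_le_sin_of_le_of_le_pi_div_two (x := Real.pi * convErr α n)
    (y := Real.pi * |j * α - round (j * α)|) (by nlinarith) (by nlinarith) (by gcongr)
  have := Real.sin_nonneg_of_nonneg_of_le_pi (x := Real.pi * convErr α n) (by positivity)
    (by nlinarith)
  gcongr

variable {ε : ℝ} (hε : 0 < ε)
include hε

theorem sq_convDenom_le_of_mem {n : ℕ} {r : ℝ}
    (hr : r ∈ coincidenceSet ε α (convDenom α (n + 2))) :
    (convDenom α (n + 2) : ℝ) ^ 2 ≤ 15 * r := by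
  obtain ⟨hr0, hr⟩ := (mem_coincidenceSet_iff hε α r (hα.one_le_convDenom _)).1 hr
  set q := convDenom α (n + 2) with hq
  have hq1 : (1 : ℝ) ≤ q := by exact_mod_cast hα.one_le_convDenom _
  have hs := mul_nonneg (sineSlope_nonneg α q) (sq_nonneg r)
  -- A competitor with j ≤ q/2 and slope O(q⁻²) suffices: 3q²/4 ≤ s_j r² gives q⁴ ≤ (640/3) r², and
  -- 640/3 < 15².
  suffices ∃ j : ℕ, 1 ≤ j ∧ 2 * j ≤ q ∧ sineSlope α j * (q : ℝ) ^ 2 ≤ 160 by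
    obtain ⟨j, hj, hjq, hsj⟩ := this
    have hjq' : 2 * (j : ℝ) ≤ q := by exact_mod_cast hjq
    have hjj : 4 * (j : ℝ) ^ 2 ≤ (q : ℝ) ^ 2 := by
      calc 4 * (j : ℝ) ^ 2 = (2 * j) ^ 2 := by ring
        _ ≤ _ := by gcongr
    have h1 : 3 * (q : ℝ) ^ 2 ≤ 4 * (sineSlope α j * r ^ 2) := by linarith [hr j hj]
    have h2 : 3 * ((q : ℝ) ^ 2) ^ 2 ≤ 640 * r ^ 2 := by
      calc 3 * ((q : ℝ) ^ 2) ^ 2 = (3 * (q : ℝ) ^ 2) * (q : ℝ) ^ 2 := by ring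
        _ ≤ (4 * (sineSlope α j * r ^ 2)) * (q : ℝ) ^ 2 := by gcongr
        _ = 4 * r ^ 2 * (sineSlope α j * (q : ℝ) ^ 2) := by ring
        _ ≤ 4 * r ^ 2 * 160 := by gcongr
        _ = _ := by ring
    exact le_of_sq_le_sq (by nlinarith) (by positivity)
  rcases le_total (2 * convDenom α (n + 1)) q with h | h
  · exact ⟨_, hα.one_le_convDenom _, h,
      (hα.sineSlope_convDenom_mul_sq_le (n + 1)).trans (by norm_num)⟩
  · refine ⟨_, hα.one_le_convDenom n, hα.two_mul_convDenom_le n, ?_⟩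
    have h' : (q : ℝ) ≤ 2 * convDenom α (n + 1) := by exact_mod_cast h
    have := hα.sineSlope_convDenom_mul_sq_le n
    have := sineSlope_nonneg α (convDenom α n)
    calc sineSlope α (convDenom α n) * (q : ℝ) ^ 2
        ≤ sineSlope α (convDenom α n) * (2 * (convDenom α (n + 1) : ℝ)) ^ 2 := by gcongr
      _ ≤ 160 := by linarith

theorem le_sq_convDenom_of_mem {n : ℕ} {r : ℝ} (hn : 4 ≤ convDenom α (n + 1))
    (hr : r ∈ coincidenceSet ε α (convDenom α n)) :
    r ≤ 2 * (convDenom α (n + 1) : ℝ) ^ 2 := by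
  obtain ⟨hr0, hr⟩ := (mem_coincidenceSet_iff hε α r (hα.one_le_convDenom _)).1 hr
  set q := convDenom α (n + 1) with hq
  -- A competitor of index at most 2q whose error is at most half of E_n: the slope gap is at least
  -- 2/q², while the intercept gap is at most 4q².
  suffices ∃ m : ℕ, convDenom α m ≤ 2 * q ∧ 2 * convErr α m ≤ convErr α n by
    obtain ⟨m, hm, hE⟩ := this
    have hm' : (convDenom α m : ℝ) ≤ 2 * q := by exact_mod_cast hm
    have h1 := hα.two_le_sineSlope_sub_mul_sq hn hE
    have h2 := hr _ (hα.one_le_convDenom m)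
    have h3 : (sineSlope α (convDenom α n) - sineSlope α (convDenom α m)) * r ^ 2 ≤ (2 * (q : ℝ)) ^ 2 := by
      calc _ ≤ (convDenom α m : ℝ) ^ 2 := by nlinarith [sq_nonneg (convDenom α n : ℝ)]
        _ ≤ _ := by gcongr
    have h4 : 2 * r ^ 2 ≤ (2 * (q : ℝ)) ^ 2 * (q : ℝ) ^ 2 := by
      calc 2 * r ^ 2 ≤ ((sineSlope α (convDenom α n) - sineSlope α (convDenom α m)) * (q : ℝ) ^ 2) *
            r ^ 2 := by gcongr
        _ = ((sineSlope α (convDenom α n) - sineSlope α (convDenom α m)) * r ^ 2) * (q : ℝ) ^ 2 := by ring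
        _ ≤ _ := by gcongr
    exact le_of_sq_le_sq (by nlinarith [sq_nonneg ((q : ℝ) ^ 2)]) (by positivity)
  rcases le_or_gt (2 * convErr α (n + 1)) (convErr α n) with h | h
  · exact ⟨n + 1, by omega, h⟩
  · obtain ⟨h1, h2⟩ := hα.recurrence_of_convErr_lt h
    have := convDenom_le_succ α n
    exact ⟨n + 2, by omega, by linarith⟩

theorem le_sq_convDenom_of_isLeast {n : ℕ} {x : ℝ} (hn : 4 ≤ convDenom α (n + 1))
    (hx : IsLeast (coincidenceSet ε α (convDenom α (n + 1))) x) :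
    x ≤ 8 * (convDenom α (n + 1) : ℝ) ^ 2 := by
  have hq1 := hα.one_le_convDenom (n + 1)
  rcases le_or_gt (2 * convErr α (n + 1)) (convErr α n) with h | h
  · by_contra! hlt
    set q := convDenom α (n + 1) with hq
    have hgap := hα.two_le_sineSlope_sub_mul_sq hn h
    have hqx : (q : ℝ) ^ 2 < x := by nlinarith [sq_nonneg (q : ℝ)]
    -- The point q² < x would already belong to the set: larger indices are beaten there because
    -- they are at x, smaller ones by the slope gap.
    refine hqx.not_ge (hx.2 ((mem_coincidenceSet_iff hε α _ hq1).2 ⟨by positivity, fun j hj => ?_⟩))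
    rcases le_or_gt q j with hqj | hjq
    · exact le_of_mem_coincidenceSet_of_le hε hq1 (by positivity) hqx.le hx.1 hqj
    · have h1 := hα.sineSlope_convDenom_le hj hjq
      have h2 : 2 * (q : ℝ) ^ 2 ≤ (sineSlope α j - sineSlope α q) * (q : ℝ) ^ 2 * (q : ℝ) ^ 2 := by
        gcongr
        refine hgap.trans ?_
        gcongr
      nlinarith [sq_nonneg (q : ℝ), sq_nonneg (j : ℝ)]
  -- Here q_{n+2} ≤ 2q_{n+1}, so the upper bound valid for every point of the set is enough.
  · obtain ⟨h1, -⟩ := hα.recurrence_of_convErr_lt h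
    rw [show n + 2 = n + 1 + 1 from rfl] at h1
    have h2 := convDenom_le_succ α n
    have h3 := convDenom_le_succ α (n + 1)
    have h4 := hα.le_sq_convDenom_of_mem hε (n := n + 1) (by omega) hx.1
    have h5 : (convDenom α (n + 1 + 1) : ℝ) ≤ 2 * convDenom α (n + 1) := by
      exact_mod_cast (by omega : convDenom α (n + 1 + 1) ≤ 2 * convDenom α (n + 1))
    calc x ≤ 2 * (convDenom α (n + 1 + 1) : ℝ) ^ 2 := h4
      _ ≤ 2 * (2 * (convDenom α (n + 1) : ℝ)) ^ 2 := by gcongr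
      _ = _ := by ring

theorem sq_convDenom_le_of_isGreatest {n : ℕ} {y : ℝ}
    (hy : IsGreatest (coincidenceSet ε α (convDenom α (n + 2))) y) :
    (convDenom α (n + 3) : ℝ) ^ 2 ≤ 60 * y := by
  have hq1 := hα.one_le_convDenom (n + 2)
  rcases le_total (convDenom α (n + 3)) (2 * convDenom α (n + 2)) with h | h
  · have h' : (convDenom α (n + 3) : ℝ) ≤ 2 * convDenom α (n + 2) := by exact_mod_cast h
    have := hα.sq_convDenom_le_of_mem hε hy.1
    calc (convDenom α (n + 3) : ℝ) ^ 2 ≤ (2 * (convDenom α (n + 2) : ℝ)) ^ 2 := by gcongr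
      _ ≤ 60 * y := by linarith
  · by_contra! hlt
    have hs := hα.sineSlope_convDenom_mul_sq_le (n + 2)
    rw [show n + 2 + 1 = n + 3 from rfl] at hs
    have h' : 2 * (convDenom α (n + 2) : ℝ) ≤ convDenom α (n + 3) := by exact_mod_cast h
    have hbest : ∀ j, 1 ≤ j → j < convDenom α (n + 3) →
        sineSlope α (convDenom α (n + 2)) ≤ sineSlope α j := fun j hj hjq => hα.sineSlope_convDenom_le hj hjq
    set q := convDenom α (n + 2)
    set q' := convDenom α (n + 3)
    have hlt' : y < (q' : ℝ) ^ 2 / 60 := by linarith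
    -- The point q'²/60 > y would belong to the set: indices in (q, q') have no smaller slope and a
    -- larger intercept. For j ≥ q' the intercept alone wins, since 40/60² + 1/4 < 1.
    refine hlt'.not_ge (hy.2 (mem_coincidenceSet_of_le_of_le hε hq1 hy.1 hlt'.le fun j hj => ?_))
    rcases lt_or_ge j q' with hjq | hjq
    · have h1 := hbest j (hq1.trans hj.le) hjq
      have h2 : (q : ℝ) ≤ j := by exact_mod_cast hj.le
      gcongr
    · have h1 : (q' : ℝ) ≤ j := by exact_mod_cast hjq
      have h2 : (q' : ℝ) ^ 2 ≤ (j : ℝ) ^ 2 := by gcongr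
      have h3 : (2 * (q : ℝ)) ^ 2 ≤ (q' : ℝ) ^ 2 := by gcongr
      have h4 : sineSlope α q * (q' : ℝ) ^ 2 * (q' : ℝ) ^ 2 ≤ 40 * (q' : ℝ) ^ 2 := by gcongr
      have h5 := mul_nonneg (sineSlope_nonneg α j) (sq_nonneg ((q' : ℝ) ^ 2 / 60))
      nlinarith [sq_nonneg (q' : ℝ)]

end Irrational

theorem mainTheorem8 :
    ∃ C : ℝ, 1 ≤ C ∧
      ∀ ε : ℝ, 0 < ε →
      ∀ α : ℝ, Irrational α → 0 < α → α < 1 →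
      ∀ᶠ n : ℕ in Filter.atTop,
        IsConstituent ε α (convDenom α n) →
        ∀ I : Set ℝ, IsMaximalInterval ε α (convDenom α n) I →
          ∃ x y : ℝ, x < y ∧ I = Set.Icc x y ∧
            C⁻¹ * (convDenom α n : ℝ) ^ 2 ≤ x ∧
            x ≤ C * (convDenom α n : ℝ) ^ 2 ∧
            C⁻¹ * (convDenom α (n + 1) : ℝ) ^ 2 ≤ y ∧
            y ≤ C * (convDenom α (n + 1) : ℝ) ^ 2 := by
  refine ⟨60, by norm_num, fun ε hε α hα _ _ => ?_⟩
  obtain ⟨N, hN⟩ := Filter.eventually_atTop.1 (hα.tendsto_convDenom.eventually_ge_atTop 4)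
  -- The shift by 2 provides the two earlier convergents used in the lower bounds.
  refine Filter.eventually_atTop.2 ⟨N + 2, fun n hn hcons I hI => ?_⟩
  obtain ⟨n, rfl⟩ : ∃ m, n = m + 2 := ⟨n - 2, by omega⟩
  have hq1 := hα.one_le_convDenom (n + 2)
  rw [hI.eq_coincidenceSet hε hq1]
  obtain ⟨a, b, hab, hsub⟩ := hcons
  have hclosed := isClosed_coincidenceSet hε α hq1
  have hord := ordConnected_coincidenceSet hε α hq1
  have hne : (coincidenceSet ε α (convDenom α (n + 2))).Nonempty :=
    (Set.nonempty_Ioo.2 hab).mono hsub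
  have hbelow : BddBelow (coincidenceSet ε α (convDenom α (n + 2))) := ⟨0, fun r hr => hr.1⟩
  have habove : BddAbove (coincidenceSet ε α (convDenom α (n + 2))) :=
    ⟨_, fun r hr => hα.le_sq_convDenom_of_mem hε (hN _ (by omega)) hr⟩
  have hx := hclosed.isLeast_csInf hne hbelow
  have hy := hclosed.isGreatest_csSup hne habove
  generalize sInf (coincidenceSet ε α (convDenom α (n + 2))) = x at hx
  generalize sSup (coincidenceSet ε α (convDenom α (n + 2))) = y at hy
  refine ⟨x, y, ?_, ?_, ?_, ?_, ?_, ?_⟩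
  · obtain ⟨c, hac, hcb⟩ := exists_between hab
    obtain ⟨d, hcd, hdb⟩ := exists_between hcb
    exact ((hx.2 (hsub ⟨hac, hcb⟩)).trans_lt hcd).trans_le (hy.2 (hsub ⟨hac.trans hcd, hdb⟩))
  · exact Set.Subset.antisymm (fun r hr => ⟨hx.2 hr, hy.2 hr⟩) (hord.out hx.1 hy.1)
  · have := hα.sq_convDenom_le_of_mem hε hx.1
    have := hx.1.1
    linarith
  · have := hα.le_sq_convDenom_of_isLeast hε (n := n + 1) (hN _ (by omega)) hx
    nlinarith [sq_nonneg (convDenom α (n + 2) : ℝ)]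
  · have := hα.sq_convDenom_le_of_isGreatest hε hy
    rw [show n + 2 + 1 = n + 3 from rfl]
    linarith
  · have := hα.le_sq_convDenom_of_mem hε (n := n + 2) (hN _ (by omega)) hy.1
    nlinarith [sq_nonneg (convDenom α (n + 2 + 1) : ℝ)]
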